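/- Let $n\ge 0$ and consider bits $1,\dots,n$. For disjoint (possibly empty) sets of bits $P,N$ and a bit $q\notin P\cup N$, the mixed-polarity multiple-control Toffoli (MPMCT) gate $\mathbf G[P,N,q]$ is the reversible function on $\{0,1\}^n$ that flips the bit $q$ if all bits in $P$ have value $1$ and all bits in $N$ have value $0$, and does nothing otherwise. An $n$-bit reversible circuit is a finite (possibly empty) sequence of such gates, executed from left to right; two circuits are equivalent, $\mathbf A\equiv\mathbf B$, if they compute the same bijection of $\{0,1\}^n$. Write $\mathrm{CNOT}[p,q]=\mathbf G[\{p\},\emptyset,q]$ and $\epsilon$ for the empty circuit. Let $\mathcal{RC}$ be the following five rules, where all the gates that are named are required to be well-formed gates $\mathbf G[\cdot,\cdot,\cdot]$. 1. $AA\leftrightarrow\epsilon$ for every gate $A$. 2. $A_0A_1\leftrightarrow A$, where $A_0=\mathbf G[P,N\cup\{p\},q]$, $A_1=\mathbf G[P\cup\{p\},N,q]$, $A=\mathbf G[P,N,q]$. 3. $AB\leftrightarrow BA$, where $A=\mathbf G[P_1,N_1,p]$, $B=\mathbf G[P_2,N_2,q]$, and $P_1\cap N_2\ne\emptyset$ or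 $P_2\cap N_1\ne\emptyset$. 4. $ABA\,C_1\leftrightarrow C_2\,ABA$, where $A=\mathrm{CNOT}[p,q]$, $B=\mathrm{CNOT}[q,p]$, $C_1=\mathbf G[P\cup P_1,N\cup N_1,p]$, $C_2=\mathbf G[P\cup P_2,N\cup N_2,q]$, and either $P_1=\{q\}$, $P_2=\{p\}$, $N_1=N_2=\emptyset$, or $N_1=\{q\}$, $N_2=\{p\}$, $P_1=P_2=\emptyset$. 5. $A_0A_1\,B_1\cdots B_{m-1}B_mB_{m-1}\cdots B_1\,A_1A_0\leftrightarrow B_1'\cdots B_{m-1}'B_m'B_{m-1}'\cdots B_1'$, where $m\ge1$, $Q=\{q_1,\dots,q_m\}$ is a set of $m$ distinct bits, $A_0=\mathbf G[P,N\cup Q,q]$, $A_1=\mathbf G[P\cup Q,N,q]$, and for $1\le i\le m$ $$B_i=\mathbf G[P\cup\{q\}\cup\{q_{i+1},\dots,q_m\},\,N\cup\{q_1,\dots,q_{i-1}\},\,q_i],$$ $$B_i'=\mathbf G[P\cup\{q_{i+1},\dots,q_m\},\,N\cup\{q\}\cup\{q_1,\dots,q_{i-1}\},\,q_i].$$ Write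 $\mathbf A\Leftrightarrow\mathbf B$ if $\mathbf A$ can be transformed into $\mathbf B$ by finitely many steps, each of which replaces a subcircuit of consecutive gates that is one side of an instance of a rule of $\mathcal{RC}$ by the other side of that instance (in either direction). **Theorem (Completeness).** For every $n$ and all $n$-bit reversible circuits $\mathbf A,\mathbf B$: if $\mathbf A\equiv\mathbf B$, then $\mathbf A\Leftrightarrow\mathbf B$. -/

import Mathlib

namespace ReversibleCircuit

/-- A mixed-polarity multiple-control Toffoli gate `G[P, N, q]` on the `n` bits `Fin n`: disjoint
(possibly empty) sets `pos` and `neg` of positive and negative control bits, and a target bit that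
is not a control bit. -/
structure Gate (n : ℕ) where
  pos : Finset (Fin n)
  neg : Finset (Fin n)
  target : Fin n
  disjoint : Disjoint pos neg
  target_notMem : target ∉ pos ∪ neg

namespace Gate

variable {n : ℕ}

/-- `A.Is P N q` says that `A` is the gate `G[P, N, q]`. -/
def Is (A : Gate n) (P N : Finset (Fin n)) (q : Fin n) : Prop :=
  A.pos = P ∧ A.neg = N ∧ A.target = q

/-- The gate fires on `x` iff all positive controls are `1` and all negative controls are `0`. -/
def Fires (A : Gate n) (x : Fin n → Bool) : Prop :=
  (∀ i ∈ A.pos, x i = true) ∧ (∀ i ∈ A.neg, x i = false)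

instance (A : Gate n) (x : Fin n → Bool) : Decidable (A.Fires x) :=
  inferInstanceAs (Decidable (_ ∧ _))

/-- The gate flips its target bit iff it fires. -/
def apply (A : Gate n) (x : Fin n → Bool) : Fin n → Bool :=
  if A.Fires x then Function.update x A.target (!x A.target) else x

theorem fires_update (A : Gate n) (x : Fin n → Bool) (b : Bool) :
    A.Fires (Function.update x A.target b) ↔ A.Fires x := by
  have h := A.target_notMem
  rw [Finset.mem_union, not_or] at h
  have hp : ∀ i ∈ A.pos, i ≠ A.target := fun i hi e => h.1 (e ▸ hi)
  have hn : ∀ i ∈ A.neg, i ≠ A.target := fun i hi e => h.2 (e ▸ hi)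
  unfold Fires
  refine and_congr (forall₂_congr fun i hi => ?_) (forall₂_congr fun i hi => ?_)
  · rw [Function.update_of_ne (hp i hi)]
  · rw [Function.update_of_ne (hn i hi)]

theorem apply_involutive (A : Gate n) : Function.Involutive A.apply := by
  intro x
  by_cases h : A.Fires x
  · simp [apply, h, fires_update]
  · simp [apply, h]

/-- The reversible function computed by a gate. -/
def toPerm (A : Gate n) : Equiv.Perm (Fin n → Bool) :=
  A.apply_involutive.toPerm

end Gate

/-- A reversible circuit on `n` bits is a finite sequence of gates; the leftmost is executed first. -/
abbrev Circuit (n : ℕ) := List (Gate n)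

variable {n : ℕ}

/-- The reversible function computed by a circuit. -/
def Circuit.eval : Circuit n → Equiv.Perm (Fin n → Bool)
  | [] => Equiv.refl _
  | A :: C => A.toPerm.trans (Circuit.eval C)

/-- `A ≡ B`: the two circuits compute the same reversible function. -/
def Circuit.Equivalent (A B : Circuit n) : Prop :=
  A.eval = B.eval

/-- The circuit `B₁ B₂ ⋯ Bₘ ⋯ B₂ B₁` (with `Bₘ` occurring once). -/
def palindrome {m : ℕ} (B : Fin m → Gate n) : Circuit n :=
  List.ofFn B ++ (List.ofFn B).dropLast.reverse

/-- The five transformation rules: `Rule L R` says that `L ≡ R` is an instance of one of them. -/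
inductive Rule : Circuit n → Circuit n → Prop
  | cancel (A : Gate n) : Rule [A, A] []
  | merge {A₀ A₁ A : Gate n} {P N : Finset (Fin n)} {p q : Fin n}
      (h₀ : A₀.Is P (N ∪ {p}) q) (h₁ : A₁.Is (P ∪ {p}) N q) (h : A.Is P N q) :
      Rule [A₀, A₁] [A]
  | commute {A B : Gate n}
      (h : (A.pos ∩ B.neg).Nonempty ∨ (B.pos ∩ A.neg).Nonempty) :
      Rule [A, B] [B, A]
  | swap {A B C₁ C₂ : Gate n} {P N P₁ P₂ N₁ N₂ : Finset (Fin n)} {p q : Fin n}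
      (hA : A.Is {p} ∅ q) (hB : B.Is {q} ∅ p)
      (hC₁ : C₁.Is (P ∪ P₁) (N ∪ N₁) p) (hC₂ : C₂.Is (P ∪ P₂) (N ∪ N₂) q)
      (h : (P₁ = {q} ∧ P₂ = {p} ∧ N₁ = ∅ ∧ N₂ = ∅) ∨
        (N₁ = {q} ∧ N₂ = {p} ∧ P₁ = ∅ ∧ P₂ = ∅)) :
      Rule [A, B, A, C₁] [C₂, A, B, A]
  | conjugate {m : ℕ} (hm : 1 ≤ m) {A₀ A₁ : Gate n} {B B' : Fin m → Gate n}
      {P N : Finset (Fin n)} {q : Fin n} {r : Fin m → Fin n} (hr : Function.Injective r)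
      (hA₀ : A₀.Is P (N ∪ Finset.univ.image r) q)
      (hA₁ : A₁.Is (P ∪ Finset.univ.image r) N q)
      (hB : ∀ i, (B i).Is ((P ∪ {q}) ∪ (Finset.Ioi i).image r) (N ∪ (Finset.Iio i).image r) (r i))
      (hB' : ∀ i,
        (B' i).Is (P ∪ (Finset.Ioi i).image r) ((N ∪ {q}) ∪ (Finset.Iio i).image r) (r i)) :
      Rule ([A₀, A₁] ++ palindrome B ++ [A₁, A₀]) (palindrome B')

/-- One application of a rule, in either direction, to a subcircuit of consecutive gates. -/
def Step (C D : Circuit n) : Prop :=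
  ∃ U L R V : Circuit n, (Rule L R ∨ Rule R L) ∧ C = U ++ L ++ V ∧ D = U ++ R ++ V

/-- `A ⇔ B`: finitely many applications of the rules transform `A` into `B` (a symmetric relation,
since each rule may be applied in either direction). -/
def Circuit.Transformable (A B : Circuit n) : Prop :=
  Relation.ReflTransGen Step A B

end ReversibleCircuit

/-! Circuits modulo the rules form a group, and completeness says that its homomorphism to the
permutations of `Fin n → Bool` is injective. Merging controls in reverse writes each gate as a
product of fully controlled gates (`closure_edge`), and such a gate is the transposition of the two
ends of an edge of the hypercube (`toPerm_edge`).

These generators satisfy the Coxeter relations of transpositions: they are involutions by rule 1,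
disjoint edges commute by rule 3, and edges that meet satisfy the braid relation (`edge_braid`),
which is extracted from rules 4 and 5 on a square. Rule 5 also expresses an edge of a square by the
other three, so the edges of one Hamiltonian path (a Gray code) generate the whole group
(`exists_path_subcube`). Along a path, the Coxeter relations already present the symmetric group:
coset enumeration, removing one vertex at a time, shows that an element acting trivially is trivial
(`eq_one_of_map_eq_one`). Of rule 5 only the case `m = 1` is needed. -/

namespace ReversibleCircuit

variable {n : ℕ}

/-! ### Gates given by control patterns -/

/-- The gate with target `q` whose control at a bit `i ≠ q` is `c i` (`none` for no control). -/
def Gate.ofControls (c : Fin n → Option Bool) (q : Fin n) : Gate n where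
  pos := {i | i ≠ q ∧ c i = some true}
  neg := {i | i ≠ q ∧ c i = some false}
  target := q
  disjoint := by
    rw [Finset.disjoint_left]
    simp +contextual
  target_notMem := by simp

@[ext]
theorem Gate.ext {A B : Gate n} (hp : A.pos = B.pos) (hn : A.neg = B.neg)
    (ht : A.target = B.target) : A = B := by
  cases A; cases B; simp_all

theorem Gate.exists_ofControls (A : Gate n) : ∃ c q, A = Gate.ofControls c q := by
  refine ⟨fun i => if i ∈ A.pos then some true else if i ∈ A.neg then some false else none,
    A.target, ?_⟩
  have h := A.target_notMem
  have hd := Finset.disjoint_left.1 A.disjoint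
  rw [Finset.mem_union, not_or] at h
  ext i
  · have : i ∈ A.pos → i ≠ A.target := fun hi e => h.1 (e ▸ hi)
    simp only [ofControls, Finset.mem_filter, Finset.mem_univ, true_and]
    split_ifs <;> simp_all
  · have : i ∈ A.neg → i ≠ A.target := fun hi e => h.2 (e ▸ hi)
    have := @hd i
    simp only [ofControls, Finset.mem_filter, Finset.mem_univ, true_and]
    split_ifs <;> simp_all
  · rfl

theorem Gate.ofControls_congr {c d : Fin n → Option Bool} {q : Fin n}
    (h : ∀ i, i ≠ q → c i = d i) : Gate.ofControls c q = Gate.ofControls d q := by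
  ext i
  · simp +contextual [ofControls, h]
  · simp +contextual [ofControls, h]
  · rfl

theorem Gate.fires_ofControls (c : Fin n → Option Bool) (q : Fin n) (x : Fin n → Bool) :
    (Gate.ofControls c q).Fires x ↔ ∀ i, i ≠ q → ∀ b, c i = some b → x i = b := by
  simp only [Fires, ofControls, Finset.mem_filter, Finset.mem_univ, true_and, Bool.forall_bool]
  constructor
  · exact fun h i hi => ⟨fun hc => h.2 i ⟨hi, hc⟩, fun hc => h.1 i ⟨hi, hc⟩⟩
  · exact fun h => ⟨fun i hi => (h i hi.1).2 hi.2, fun i hi => (h i hi.1).1 hi.2⟩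

theorem Gate.fires_ofControls_update {c : Fin n → Option Bool} {q r : Fin n} (hr : r ≠ q)
    (b : Bool) (x : Fin n → Bool) :
    (Gate.ofControls (Function.update c r (some b)) q).Fires x ↔
      x r = b ∧ ∀ i, i ≠ q → i ≠ r → ∀ b, c i = some b → x i = b := by
  rw [fires_ofControls]
  constructor
  · intro h
    refine ⟨h r hr b (by simp), fun i hi hir b hb => h i hi b (by simpa [hir] using hb)⟩
  · rintro ⟨h₁, h₂⟩ i hi b' hb
    by_cases hir : i = r
    · subst hir
      simp at hb
      rw [h₁, hb]
    · exact h₂ i hi hir b' (by simpa [hir] using hb)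

theorem Gate.toPerm_apply (A : Gate n) (x : Fin n → Bool) : A.toPerm x = A.apply x := rfl

theorem Gate.apply_of_fires (A : Gate n) {x : Fin n → Bool} (h : A.Fires x) :
    A.apply x = Function.update x A.target (!x A.target) := if_pos h

theorem Gate.apply_of_not_fires (A : Gate n) {x : Fin n → Bool} (h : ¬ A.Fires x) :
    A.apply x = x := if_neg h

theorem Circuit.eval_append (A B : Circuit n) :
    Circuit.eval (A ++ B) = (Circuit.eval A).trans (Circuit.eval B) := by
  induction A with
  | nil => rfl
  | cons G A ih => simp [Circuit.eval, ih, Equiv.trans_assoc]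

/-! ### The group of circuits modulo the rules -/

theorem Step.symm {A B : Circuit n} (h : Step A B) : Step B A := by
  obtain ⟨U, L, R, V, h, rfl, rfl⟩ := h
  exact ⟨U, R, L, V, h.symm, rfl, rfl⟩

theorem Step.append {A B : Circuit n} (h : Step A B) (U V : Circuit n) :
    Step (U ++ A ++ V) (U ++ B ++ V) := by
  obtain ⟨U', L, R, V', h, rfl, rfl⟩ := h
  exact ⟨U ++ U', L, R, V' ++ V, h, by simp, by simp⟩

namespace Circuit.Transformable

theorem symm {A B : Circuit n} (h : A.Transformable B) : B.Transformable A := by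
  induction h with
  | refl => exact .refl
  | tail _ h ih => exact .head h.symm ih

theorem append {A B C D : Circuit n} (h : A.Transformable B) (h' : C.Transformable D) :
    Circuit.Transformable (A ++ C) (B ++ D) := by
  refine Relation.ReflTransGen.trans (b := B ++ C) ?_ ?_
  · induction h with
    | refl => exact .refl
    | tail _ h ih => exact ih.tail (by simpa using h.append [] C)
  · induction h' with
    | refl => exact .refl
    | tail _ h ih => exact ih.tail (by simpa using h.append B [])

theorem of_rule {A B : Circuit n} (h : Rule A B) : A.Transformable B :=
  .single ⟨[], A, B, [], .inl h, by simp, by simp⟩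

end Circuit.Transformable

/-- The congruence on circuits whose classes consist of circuits that can be transformed into
each other and compute the same function. -/
def circuitCon (n : ℕ) : Con (FreeMonoid (Gate n)) where
  -- Requiring equal functions as well makes the evaluation map well defined without soundness of
  -- every rule; soundness is checked only for the instances used.
  r A B := Circuit.Transformable A.toList B.toList ∧ Circuit.eval A.toList = Circuit.eval B.toList
  iseqv :=
    ⟨fun _ => ⟨.refl, rfl⟩, fun h => ⟨h.1.symm, h.2.symm⟩,
      fun h h' => ⟨Relation.ReflTransGen.trans h.1 h'.1, h.2.trans h'.2⟩⟩
  mul' h h' := ⟨h.1.append h'.1, by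
    rw [FreeMonoid.toList_mul, FreeMonoid.toList_mul, Circuit.eval_append, Circuit.eval_append,
      h.2, h'.2]⟩

/-- Circuits modulo the transformation rules. -/
abbrev CircuitGroup (n : ℕ) := (circuitCon n).Quotient

/-- The class of a circuit. -/
def Circuit.cls (A : Circuit n) : CircuitGroup n := ((FreeMonoid.ofList A : FreeMonoid (Gate n)) :)

/-- The class of a gate. -/
def Gate.cls (A : Gate n) : CircuitGroup n := Circuit.cls [A]

theorem Circuit.cls_eq_iff {A B : Circuit n} :
    A.cls = B.cls ↔ A.Transformable B ∧ A.eval = B.eval :=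
  (circuitCon n).eq

theorem Circuit.exists_cls_eq (g : CircuitGroup n) : ∃ C : Circuit n, g = C.cls := by
  induction g using Con.induction_on with
  | _ C => exact ⟨C.toList, rfl⟩

theorem Circuit.eval_cons_apply (A : Gate n) (C : Circuit n) (x : Fin n → Bool) :
    Circuit.eval (A :: C) x = Circuit.eval C (A.apply x) := rfl

theorem Circuit.eval_nil_apply (x : Fin n → Bool) : Circuit.eval ([] : Circuit n) x = x := rfl

theorem Gate.cls_mul_self (A : Gate n) : A.cls * A.cls = 1 := by
  change Circuit.cls [A, A] = Circuit.cls []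
  rw [Circuit.cls_eq_iff]
  exact ⟨.of_rule (.cancel A), Equiv.ext fun x => A.apply_involutive x⟩

theorem Circuit.isUnit_cls (C : Circuit n) : IsUnit C.cls := by
  induction C with
  | nil => exact isUnit_one
  | cons A C ih => exact .mul ⟨⟨A.cls, A.cls, A.cls_mul_self, A.cls_mul_self⟩, rfl⟩ ih

noncomputable instance : Group (CircuitGroup n) :=
  groupOfIsUnit fun g => by
    obtain ⟨C, rfl⟩ := Circuit.exists_cls_eq g
    exact C.isUnit_cls

/-- The function computed by a circuit, inverted so as to be multiplicative. -/
def CircuitGroup.toPerm : CircuitGroup n →* Equiv.Perm (Fin n → Bool) :=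
  (circuitCon n).lift
    { toFun := fun A => (Circuit.eval A.toList)⁻¹
      map_one' := rfl
      map_mul' := fun A B => by rw [FreeMonoid.toList_mul, Circuit.eval_append]; rfl }
    fun _ _ h => congrArg (·⁻¹) h.2

theorem CircuitGroup.toPerm_cls (C : Circuit n) : toPerm C.cls = C.eval⁻¹ := rfl

theorem CircuitGroup.toPerm_gate (A : Gate n) : toPerm A.cls = A.toPerm := by
  change (Circuit.eval [A])⁻¹ = A.toPerm
  rw [inv_eq_iff_mul_eq_one]
  exact Equiv.ext fun x => A.apply_involutive x

/-! ### The rules as relations in the group -/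

theorem Gate.cls_merge {c : Fin n → Option Bool} {q r : Fin n} (hr : r ≠ q) (hc : c r = none) :
    (ofControls (Function.update c r (some false)) q).cls *
      (ofControls (Function.update c r (some true)) q).cls = (ofControls c q).cls := by
  change Circuit.cls [_, _] = Circuit.cls [_]
  rw [Circuit.cls_eq_iff]
  constructor
  · refine .of_rule (.merge (P := (ofControls c q).pos) (N := (ofControls c q).neg) (p := r)
      (q := q) ⟨?_, ?_, rfl⟩ ⟨?_, ?_, rfl⟩ ⟨rfl, rfl, rfl⟩)
    all_goals
      ext i
      by_cases hi : i = r
      · subst hi; simp [ofControls, hr, hc]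
      · simp [ofControls, hi]
  · ext1 x
    simp only [Circuit.eval_cons_apply, Circuit.eval_nil_apply]
    have key : (ofControls c q).Fires x ↔ ∀ i, i ≠ q → i ≠ r → ∀ b, c i = some b → x i = b := by
      rw [fires_ofControls]
      refine ⟨fun h i hi _ => h i hi, fun h i hi b hb => h i hi ?_ b hb⟩
      rintro rfl
      simp [hc] at hb
    by_cases hW : (ofControls c q).Fires x
    · have hW' := key.1 hW
      cases hx : x r
      · rw [apply_of_fires _ ((fires_ofControls_update hr _ _).2 ⟨hx, hW'⟩),
          apply_of_not_fires, apply_of_fires _ hW]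
        · rfl
        · rw [fires_ofControls_update hr]
          simp [ofControls, hr, hx]
      · rw [apply_of_not_fires (ofControls (Function.update c r (some false)) q),
          apply_of_fires _ ((fires_ofControls_update hr _ _).2 ⟨hx, hW'⟩),
          apply_of_fires _ hW]
        · rfl
        · rw [fires_ofControls_update hr]
          simp [hx]
    · have hW' (b) : ¬ (ofControls (Function.update c r (some b)) q).Fires x := by
        rw [fires_ofControls_update hr, ← key]
        exact fun h => hW h.2
      rw [apply_of_not_fires _ (hW' _), apply_of_not_fires _ (hW' _), apply_of_not_fires _ hW]

theorem Gate.cls_commute {c d : Fin n → Option Bool} {q p r : Fin n} {b : Bool}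
    (hq : r ≠ q) (hp : r ≠ p) (hc : c r = some b) (hd : d r = some (!b)) :
    Commute (ofControls c q).cls (ofControls d p).cls := by
  change Circuit.cls [_, _] = Circuit.cls [_, _]
  rw [Circuit.cls_eq_iff]
  constructor
  · refine .of_rule (.commute ?_)
    cases b
    · exact .inr ⟨r, by simp [ofControls, hq, hp, hc, hd]⟩
    · exact .inl ⟨r, by simp [ofControls, hq, hp, hc, hd]⟩
  · ext1 x
    simp only [Circuit.eval_cons_apply, Circuit.eval_nil_apply]
    have e (d p) (x : Fin n → Bool) : (ofControls d p).apply x =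
      if (ofControls d p).Fires x then Function.update x p (!x p) else x := rfl
    have hn (x : Fin n → Bool) (h : x r = b) : ¬ (ofControls d p).Fires x := by
      rw [fires_ofControls]
      intro h'
      simpa [h] using h' r hp _ hd
    have hn' (x : Fin n → Bool) (h : x r ≠ b) : ¬ (ofControls c q).Fires x := by
      rw [fires_ofControls]
      intro h'
      exact h (h' r hq _ hc)
    have hA (x : Fin n → Bool) (h : x r = b) : (ofControls d p).apply x = x := by
      rw [e, if_neg (hn x h)]
    have hB (x : Fin n → Bool) (h : x r ≠ b) : (ofControls c q).apply x = x := by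
      rw [e, if_neg (hn' x h)]
    have hr1 (x : Fin n → Bool) : (ofControls c q).apply x r = x r := by
      rw [e]; split_ifs <;> simp [hq]
    have hr2 (x : Fin n → Bool) : (ofControls d p).apply x r = x r := by
      rw [e]; split_ifs <;> simp [hp]
    by_cases h : x r = b
    · rw [hA x h, hA _ (by rw [hr1, h])]
    · rw [hB x h, hB _ (by rw [hr2]; exact h)]

/-- The controls in `c` at bits other than `p` and `q` are satisfied by `x`. -/
def ControlsHold (c : Fin n → Option Bool) (p q : Fin n) (x : Fin n → Bool) : Prop :=
  ∀ i, i ≠ p → i ≠ q → ∀ b, c i = some b → x i = b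

theorem controlsHold_swap {c : Fin n → Option Bool} {p q : Fin n} {x : Fin n → Bool} :
    ControlsHold c p q x ↔ ControlsHold c q p x :=
  forall_congr' fun _ => forall_comm

theorem controlsHold_update_left {c : Fin n → Option Bool} {p q : Fin n} {x : Fin n → Bool}
    {b : Bool} : ControlsHold c p q (Function.update x p b) ↔ ControlsHold c p q x := by
  refine forall_congr' fun i => forall_congr' fun hi => ?_
  rw [Function.update_of_ne hi]

theorem controlsHold_update_right {c : Fin n → Option Bool} {p q : Fin n} {x : Fin n → Bool}
    {b : Bool} : ControlsHold c p q (Function.update x q b) ↔ ControlsHold c p q x := by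
  rw [controlsHold_swap, controlsHold_update_left, controlsHold_swap]

open Classical in
theorem Gate.apply_ofControls_update {c : Fin n → Option Bool} {q r : Fin n} (hr : r ≠ q)
    (b : Bool) (x : Fin n → Bool) :
    (ofControls (Function.update c r (some b)) q).apply x =
      if ControlsHold c q r x then Function.update x q (x q ^^ (x r == b)) else x := by
  by_cases h : ControlsHold c q r x
  · rw [if_pos h]
    by_cases hb : x r = b
    · rw [apply_of_fires _ ((fires_ofControls_update hr b x).2 ⟨hb, h⟩)]
      simp [hb, ofControls]
    · rw [apply_of_not_fires]
      · simp [beq_eq_false_iff_ne.2 hb]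
      · rw [fires_ofControls_update hr]
        exact fun h => hb h.1
  · rw [if_neg h, apply_of_not_fires]
    rw [fires_ofControls_update hr]
    exact fun h' => h h'.2

theorem Gate.cls_swap (c : Fin n → Option Bool) {p q : Fin n} (hpq : p ≠ q) (b : Bool) :
    (ofControls (Function.update (fun _ => none) p (some true)) q).cls *
      (ofControls (Function.update (fun _ => none) q (some true)) p).cls *
      (ofControls (Function.update (fun _ => none) p (some true)) q).cls *
      (ofControls (Function.update c q (some b)) p).cls =
    (ofControls (Function.update c p (some b)) q).cls *
      ((ofControls (Function.update (fun _ => none) p (some true)) q).cls *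
      (ofControls (Function.update (fun _ => none) q (some true)) p).cls *
      (ofControls (Function.update (fun _ => none) p (some true)) q).cls) := by
  simp only [mul_assoc]
  change Circuit.cls [_, _, _, _] = Circuit.cls [_, _, _, _]
  rw [Circuit.cls_eq_iff]
  constructor
  · refine .of_rule (.swap (p := p) (q := q)
      (P := {i | i ≠ p ∧ i ≠ q ∧ c i = some true})
      (N := {i | i ≠ p ∧ i ≠ q ∧ c i = some false})
      (P₁ := if b then {q} else ∅) (P₂ := if b then {p} else ∅)
      (N₁ := if b then ∅ else {q}) (N₂ := if b then ∅ else {p})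
      ⟨?_, ?_, rfl⟩ ⟨?_, ?_, rfl⟩ ⟨?_, ?_, rfl⟩ ⟨?_, ?_, rfl⟩ ?_)
    all_goals try
      ext i
      by_cases hp : i = p
      · subst hp; cases b <;> simp [ofControls, hpq]
      · by_cases hq : i = q
        · subst hq; cases b <;> simp [ofControls, hpq.symm]
        · cases b <;> simp [ofControls, hp, hq]
    cases b <;> simp
  · have hn (p q x) : ControlsHold (fun _ : Fin n => none) p q x := fun i _ _ b hb => by simp at hb
    have e := fun c b x => apply_ofControls_update (c := c) hpq b x
    have e' := fun c b x => apply_ofControls_update (c := c) hpq.symm b x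
    ext x i
    have hs (x) : ControlsHold c p q x = ControlsHold c q p x := propext controlsHold_swap
    by_cases hW : ControlsHold c q p x
    · simp only [Circuit.eval_cons_apply, Circuit.eval_nil_apply, e, e', hn, hs, hW, if_true,
        controlsHold_update_left, controlsHold_update_right]
      by_cases hp : i = p
      · subst hp; cases b <;> cases hi : x i <;> cases hj : x q <;> simp [hpq, hpq.symm, hi]
      · by_cases hq : i = q
        · subst hq; cases b <;> cases hi : x i <;> cases hj : x p <;> simp [hpq, hpq.symm, hj]
        · simp [hp, hq]
    · simp only [Circuit.eval_cons_apply, Circuit.eval_nil_apply, e, e', hn, hs, hW, if_true,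
        if_false, controlsHold_update_left, controlsHold_update_right]

theorem Gate.cls_conjugate (c : Fin n → Option Bool) {p q : Fin n} (hpq : p ≠ q) :
    (ofControls (Function.update c p (some false)) q).cls *
      (ofControls (Function.update c p (some true)) q).cls *
      (ofControls (Function.update c q (some true)) p).cls *
      (ofControls (Function.update c p (some true)) q).cls *
      (ofControls (Function.update c p (some false)) q).cls =
    (ofControls (Function.update c q (some false)) p).cls := by
  simp only [mul_assoc]
  change Circuit.cls [_, _, _, _, _] = Circuit.cls [_]
  rw [Circuit.cls_eq_iff]
  constructor
  · have key := Rule.conjugate (m := 1) le_rfl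
      (A₀ := ofControls (Function.update c p (some false)) q)
      (A₁ := ofControls (Function.update c p (some true)) q)
      (B := fun _ => ofControls (Function.update c q (some true)) p)
      (B' := fun _ => ofControls (Function.update c q (some false)) p)
      (P := {i | i ≠ p ∧ i ≠ q ∧ c i = some true})
      (N := {i | i ≠ p ∧ i ≠ q ∧ c i = some false}) (q := q) (r := fun _ => p)
      (Function.injective_of_subsingleton _)
      ⟨?_, ?_, rfl⟩ ⟨?_, ?_, rfl⟩ (fun j => ⟨?_, ?_, rfl⟩) (fun j => ⟨?_, ?_, rfl⟩)
    · simpa [palindrome] using Circuit.Transformable.of_rule key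
    all_goals
      ext i
      by_cases hp : i = p
      · subst hp; simp [ofControls, hpq]
      · by_cases hq : i = q
        · subst hq; simp [ofControls, hpq.symm, hpq]
        · simp [ofControls, hp, hq, Ne.symm hp]
  · have e := fun b x => apply_ofControls_update (c := c) hpq b x
    have e' := fun b x => apply_ofControls_update (c := c) hpq.symm b x
    ext x i
    have hs (x) : ControlsHold c p q x = ControlsHold c q p x := propext controlsHold_swap
    by_cases hW : ControlsHold c q p x
    · simp only [Circuit.eval_cons_apply, Circuit.eval_nil_apply, e, e', hs, hW, if_true,
        controlsHold_update_left, controlsHold_update_right]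
      by_cases hp : i = p
      · subst hp; cases hi : x i <;> cases hj : x q <;> simp [hpq, hpq.symm, hi]
      · by_cases hq : i = q
        · subst hq; cases hi : x i <;> cases hj : x p <;> simp [hpq, hpq.symm, hi, hj]
        · simp [hp, hq]
    · simp only [Circuit.eval_cons_apply, Circuit.eval_nil_apply, e, e', hs, hW, if_false]

/-! ### Fully controlled gates as generators -/

/-- The class of the gate with target `q` that has all other bits as controls, with polarities
given by `x`; it exchanges the two ends of the edge at `x` in direction `q` of the hypercube. -/
def edge (x : Fin n → Bool) (q : Fin n) : CircuitGroup n :=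
  (Gate.ofControls (fun i => some (x i)) q).cls

theorem edge_mul_self (x : Fin n → Bool) (q : Fin n) : edge x q * edge x q = 1 :=
  Gate.cls_mul_self _

theorem edge_update_self (x : Fin n → Bool) (q : Fin n) (b : Bool) :
    edge (Function.update x q b) q = edge x q := by
  refine congrArg Gate.cls (Gate.ofControls_congr fun i hi => ?_)
  rw [Function.update_of_ne hi]

theorem edge_commute {x y : Fin n → Bool} {p q r : Fin n} (hp : r ≠ p) (hq : r ≠ q)
    (h : x r ≠ y r) : Commute (edge x p) (edge y q) :=
  Gate.cls_commute hp hq rfl (by rw [Bool.eq_not_of_ne h.symm])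

theorem edge_update_eq (x : Fin n → Bool) (p q : Fin n) (b : Bool) :
    edge (Function.update x p b) q =
      (Gate.ofControls (Function.update (fun i => some (x i)) p (some b)) q).cls := by
  refine congrArg Gate.cls (Gate.ofControls_congr fun i hi => ?_)
  by_cases h : i = p
  · subst h; simp
  · simp [h]

theorem Gate.cls_merge_not {c : Fin n → Option Bool} {q r : Fin n} (hr : r ≠ q) (hc : c r = none)
    (b : Bool) : (ofControls (Function.update c r (some (!b))) q).cls *
      (ofControls (Function.update c r (some b)) q).cls = (ofControls c q).cls := by
  cases b
  · rw [← cls_merge hr hc]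
    exact (cls_commute (r := r) (b := true) hr hr (by simp) (by simp)).eq
  · exact cls_merge hr hc

/-- Splitting a gate at an uncontrolled bit by rule 2 gives two gates with fewer missing controls,
whence the induction on their number. A submonoid suffices throughout because the generators are
involutions. -/
theorem Gate.cls_mem_closure_edge (c : Fin n → Option Bool) (q : Fin n) :
    (ofControls c q).cls ∈ Submonoid.closure {g | ∃ x p, g = edge (n := n) x p} := by
  induction hk : (Finset.univ.filter fun i => i ≠ q ∧ c i = none).card using
    Nat.strong_induction_on generalizing c with
  | _ k ih =>
    by_cases h : ∃ r, r ≠ q ∧ c r = none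
    · obtain ⟨r, hr, hc⟩ := h
      have key (b : Bool) : (ofControls (Function.update c r (some b)) q).cls ∈
          Submonoid.closure {g | ∃ x p, g = edge (n := n) x p} := by
        refine ih _ ?_ _ rfl
        rw [← hk]
        refine Finset.card_lt_card ⟨fun i => ?_, fun hs => ?_⟩
        · by_cases hi : i = r
          · subst hi; simp
          · simp [hi]
        · have := hs (x := r) (by simp [hr, hc])
          simp at this
      rw [← cls_merge hr hc]
      exact mul_mem (key _) (key _)
    · push Not at h
      -- The default `true` is used at most at the target `q`, where the pattern is irrelevant.
      refine Submonoid.subset_closure ⟨fun i => (c i).getD true, q, ?_⟩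
      refine congrArg Gate.cls (ofControls_congr fun i hi => ?_)
      obtain ⟨b, hb⟩ := Option.ne_none_iff_exists'.1 (h i hi)
      simp [hb]

theorem closure_edge : Submonoid.closure {g | ∃ x p, g = edge (n := n) x p} = ⊤ := by
  rw [eq_top_iff]
  rintro g -
  obtain ⟨C, rfl⟩ := Circuit.exists_cls_eq g
  induction C with
  | nil => exact one_mem _
  | cons A C ih =>
    obtain ⟨c, q, rfl⟩ := A.exists_ofControls
    exact mul_mem (Gate.cls_mem_closure_edge c q) ih

/-! ### Relations on a square of the hypercube -/

/-- Here `a' * a` and `b' * b` are gates split at one bit, with the wrong polarity in the primed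
factors. Those factors collect into `a' * b' * a'` on the left, which commutes with `d` and can be
cancelled. -/
theorem mul_swap_cancel {G : Type*} [Group G] {a a' b b' c d : G} (haa : Commute a' a)
    (hab : Commute a' b) (hba : Commute b' a) (had : Commute a' d)
    (hbd : Commute b' d)
    (h : (a' * a) * (b' * b) * (a' * a) * c = d * ((a' * a) * (b' * b) * (a' * a))) :
    a * b * a * c = d * (a * b * a) := by
  have e : (a' * a) * (b' * b) * (a' * a) = (a' * b' * a') * (a * b * a) := by
    rw [hba.symm.mul_mul_mul_comm, (haa.mul_right hab).symm.mul_mul_mul_comm]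
  have hX : Commute (a' * b' * a') d := (had.mul_left hbd).mul_left had
  rw [e] at h
  generalize a' * b' * a' = X, a * b * a = Y at h hX ⊢
  rw [mul_assoc, ← mul_assoc d, ← hX.eq, mul_assoc X d] at h
  exact mul_left_cancel h

/-- The controls `x i` at the bits `i ∈ S`. -/
def partialControls (x : Fin n → Bool) (S : Finset (Fin n)) (i : Fin n) : Option Bool :=
  if i ∈ S then some (x i) else none

/-- Rule 4 conjugates by uncontrolled CNOT gates. Controls agreeing with `x` are added to these
gates one bit at a time until the exchange takes place inside a single square. -/
theorem cls_partial_swap (x : Fin n → Bool) {p q : Fin n} (hpq : p ≠ q) (b : Bool)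
    (S : Finset (Fin n)) :
    (Gate.ofControls (Function.update (partialControls x S) p (some true)) q).cls *
      (Gate.ofControls (Function.update (partialControls x S) q (some true)) p).cls *
      (Gate.ofControls (Function.update (partialControls x S) p (some true)) q).cls *
      edge (Function.update x q b) p =
    edge (Function.update x p b) q *
      ((Gate.ofControls (Function.update (partialControls x S) p (some true)) q).cls *
      (Gate.ofControls (Function.update (partialControls x S) q (some true)) p).cls *
      (Gate.ofControls (Function.update (partialControls x S) p (some true)) q).cls) := by
  induction S using Finset.induction_on with
  | empty =>
    rw [edge_update_eq, edge_update_eq]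
    exact Gate.cls_swap _ hpq b
  | insert r S hr ih =>
    -- A control at `p` or `q` changes nothing: one of the two bits is the target, and the control
    -- at the other is overwritten.
    by_cases hrpq : r = p ∨ r = q
    · have e (p' q') (h : p' = p ∧ q' = q ∨ p' = q ∧ q' = p) : Gate.ofControls
          (Function.update (partialControls x (insert r S)) p' (some true)) q' =
          Gate.ofControls (Function.update (partialControls x S) p' (some true)) q' := by
        refine Gate.ofControls_congr fun i hi => ?_
        by_cases hi' : i = p'
        · subst hi'; simp
        · have : i ≠ r := by rintro rfl; grind
          simp [hi', partialControls, this]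
      rw [e p q (by simp), e q p (by simp)]
      exact ih
    · push Not at hrpq
      have e (p') (hp' : r ≠ p') : Function.update (partialControls x (insert r S)) p' (some true) =
          Function.update (Function.update (partialControls x S) p' (some true)) r
            (some (x r)) := by
        rw [Function.update_comm hp'.symm]
        congr 1
        funext i
        by_cases hi : i = r
        · subst hi; simp [partialControls]
        · simp [partialControls, hi]
      rw [← Gate.cls_merge_not (r := r) hrpq.2 (by simp [hrpq.1, partialControls, hr]) (x r),
        ← Gate.cls_merge_not (r := r) hrpq.1 (by simp [hrpq.2, partialControls, hr]) (x r)] at ih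
      rw [e p hrpq.1, e q hrpq.2]
      refine mul_swap_cancel ?_ ?_ ?_ ?_ ?_ ih
      all_goals
        refine Gate.cls_commute (r := r) (b := !x r) ?_ ?_ ?_ ?_
        all_goals simp [hrpq.1, hrpq.2]

theorem edge_square_swap (x : Fin n → Bool) {p q : Fin n} (hpq : p ≠ q) (b : Bool) :
    edge (Function.update x p true) q * edge (Function.update x q true) p *
      edge (Function.update x p true) q * edge (Function.update x q b) p =
    edge (Function.update x p b) q * (edge (Function.update x p true) q *
      edge (Function.update x q true) p * edge (Function.update x p true) q) := by
  have h := cls_partial_swap x hpq b Finset.univ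
  have e : partialControls x Finset.univ = fun i => some (x i) := by
    funext i; simp [partialControls]
  rwa [e, ← edge_update_eq, ← edge_update_eq] at h

theorem edge_square_conj (x : Fin n → Bool) {p q : Fin n} (hpq : p ≠ q) :
    edge (Function.update x p false) q * edge (Function.update x p true) q *
      edge (Function.update x q true) p * edge (Function.update x p true) q *
      edge (Function.update x p false) q = edge (Function.update x q false) p := by
  simp only [edge_update_eq]
  exact Gate.cls_conjugate _ hpq

/-- The edges `a`, `c` are opposite in a square, as are `b`, `d`. The three conclusions are the
braid relations at three of its corners; exchanging the two directions yields the fourth. -/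
theorem braid_of_square {G : Type*} [Group G] {a b c d : G} (ha : a * a = 1) (hb : b * b = 1)
    (hc : c * c = 1) (hbd : Commute b d)
    (hab : a * b * a * b = a * (a * b * a)) (hcd : a * b * a * d = c * (a * b * a))
    (h : c * a * b * a * c = d) :
    a * b * a = b * a * b ∧ c * d * c = d * c * d ∧ b * c * b = c * b * c := by
  have hb' (y : G) : b * (b * y) = y := by rw [← mul_assoc, hb, one_mul]
  have hc' (y : G) : c * (c * y) = y := by rw [← mul_assoc, hc, one_mul]
  have ha' (y : G) : a * (a * y) = y := by rw [← mul_assoc, ha, one_mul]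
  have h1 : a * b * a = b * a * b := by
    simpa [mul_assoc, ha', hb] using congrArg (· * b) hab
  obtain ⟨s, hs⟩ : ∃ s, s = a * b * a := ⟨_, rfl⟩
  have hs' : s = b * a * b := hs.trans h1
  have hss : s * s = 1 := by simp [hs, mul_assoc, ha', hb', ha]
  have hss' (y : G) : s * (s * y) = y := by rw [← mul_assoc, hss, one_mul]
  have hbs : b * s * b = a := by simp [hs', mul_assoc, hb', hb]
  have hsb : s * b * s = a := by
    rw [hs, mul_assoc, ← mul_assoc, h1]
    simp only [mul_assoc, hb']
    rw [← mul_assoc, ← mul_assoc, ← h1]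
    simp [mul_assoc, ha', hb]
  rw [← hs] at hcd
  have hcsc : c * s * c = d := by rw [← h, hs]; simp only [mul_assoc]
  have hdc : d * c = c * s := by rw [← hcsc, mul_assoc, hc, mul_one]
  have hscs : s * c * s = d := by rw [mul_assoc, ← hdc, ← mul_assoc, hcd, hcsc]
  have hsd : s * d * s = c := by simp [← hscs, mul_assoc, hss', hss]
  have hcdc : c * d * c = s := by simp [← hcsc, mul_assoc, hc', hc]
  have hdcd : d * c * d = s := by rw [hdc, mul_assoc, hcd, hc']
  have hdsd : d * s * d = c := by rw [mul_assoc, hcd, ← mul_assoc, hdc, mul_assoc, hss, mul_one]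
  refine ⟨h1, hcdc.trans hdcd.symm, ?_⟩
  -- Conjugation by `s * b` takes `s` to `b` and `d` to `c`, so the braid relation of `s` and `d`
  -- becomes that of `b` and `c`.
  have k1 : SemiconjBy (s * b) s b := by
    change s * b * s = b * (s * b)
    rw [hsb, ← mul_assoc, hbs]
  have k2 : SemiconjBy (s * b) d c := by
    change s * b * d = c * (s * b)
    rw [mul_assoc, hbd.eq, ← mul_assoc, hcd, mul_assoc]
  have k3 := ((k1.mul_right k2).mul_right k1).eq
  have k4 := ((k2.mul_right k1).mul_right k2).eq
  rw [hsd.trans hdsd.symm] at k3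
  exact mul_right_cancel (k3.symm.trans k4)

theorem edge_braid (x : Fin n → Bool) {p q : Fin n} (hpq : p ≠ q) :
    edge x p * edge x q * edge x p = edge x q * edge x p * edge x q := by
  have key {p q : Fin n} (hpq : p ≠ q) :=
    braid_of_square (edge_mul_self (Function.update x p true) q)
      (edge_mul_self (Function.update x q true) p) (edge_mul_self (Function.update x p false) q)
      (edge_commute (r := q) hpq.symm hpq.symm (by simp))
      (edge_square_swap x hpq true) (edge_square_swap x hpq false) (edge_square_conj x hpq)
  have e₁ : edge x p = edge (Function.update x q (x q)) p := by rw [Function.update_eq_self]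
  have e₂ : edge x q = edge (Function.update x p (x p)) q := by rw [Function.update_eq_self]
  rw [e₁, e₂]
  obtain ⟨h₁, h₂, h₃⟩ := key hpq
  obtain ⟨-, -, h₄⟩ := key hpq.symm
  cases hp : x p <;> cases hq : x q
  · exact h₂.symm
  · exact h₃
  · exact h₄.symm
  · exact h₁.symm

/-- Rule 5 conjugates one `q`-edge of a square into the other by means of the two `p`-edges, so
three edges generate the fourth. -/
theorem edge_mem_of_square {H : Submonoid (CircuitGroup n)} {x : Fin n → Bool} {p q : Fin n}
    (hpq : p ≠ q) (h : ∀ b, edge (Function.update x q b) p ∈ H) {b : Bool}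
    (hb : edge (Function.update x p b) q ∈ H) (b' : Bool) :
    edge (Function.update x p b') q ∈ H := by
  by_cases hbb : b' = b
  · rwa [hbb]
  rw [Bool.eq_not_of_ne hbb]
  have h1 := edge_square_conj x hpq.symm
  cases b
  · have h2 := h true
    have h3 := h false
    have e : edge (Function.update x p true) q = edge (Function.update x q true) p *
        edge (Function.update x q false) p * edge (Function.update x p false) q *
        edge (Function.update x q false) p * edge (Function.update x q true) p := by
      rw [← h1]
      simp only [mul_assoc, edge_mul_self, mul_one]
      simp only [← mul_assoc, edge_mul_self, one_mul]
    rw [Bool.not_false, e]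
    exact mul_mem (mul_mem (mul_mem (mul_mem h2 h3) hb) h3) h2
  · rw [Bool.not_true, ← h1]
    exact mul_mem (mul_mem (mul_mem (mul_mem (h _) (h _)) hb) (h _)) (h _)

/-! ### Coxeter relations along a path -/

section Path

variable {V G : Type*}

theorem adj_of_infix {adj : V → V → Prop} {L : List V} (hL : L.IsChain adj) {v w : V}
    (h : [v, w] <:+: L) : adj v w := by
  simpa using hL.infix h

/-- The transpositions along a path. -/
def pathEdges (t : V → V → G) (L : List V) : Set G := {g | ∃ v w, [v, w] <:+: L ∧ g = t v w}

variable {t : V → V → G}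

theorem mem_pathEdges_cons_cons {v w : V} {L : List V} {g : G} :
    g ∈ pathEdges t (v :: w :: L) ↔ g = t v w ∨ g ∈ pathEdges t (w :: L) := by
  simp only [pathEdges, Set.mem_ofPred_eq, List.infix_cons_iff (l₂ := w :: L)]
  constructor
  · rintro ⟨x, y, h | h, rfl⟩
    · simp only [List.cons_prefix_cons, List.nil_prefix, and_true] at h
      obtain ⟨rfl, rfl⟩ := h
      exact .inl rfl
    · exact .inr ⟨x, y, h, rfl⟩
  · rintro (rfl | ⟨x, y, h, rfl⟩)
    · exact ⟨v, w, .inl (by simp), rfl⟩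
    · exact ⟨x, y, .inr h, rfl⟩

theorem pathEdges_subset {L M : List V} (h : L <:+: M) : pathEdges t L ⊆ pathEdges t M := by
  rintro g ⟨v, w, hvw, rfl⟩
  exact ⟨v, w, hvw.trans h, rfl⟩

theorem not_mem_pathEdges_singleton {v : V} {g : G} : g ∉ pathEdges t [v] := by
  rintro ⟨x, y, h, -⟩
  have := h.length_le
  simp at this

variable [Group G]

/-- The products of the transpositions along the initial segments of a path. -/
def pathProds (t : V → V → G) : List V → Set G
  | v :: w :: L => insert 1 ((t v w * ·) '' pathProds t (w :: L))
  | _ => {1}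

theorem one_mem_pathProds (L : List V) : (1 : G) ∈ pathProds t L := by
  rcases L with _ | ⟨v, _ | ⟨w, L⟩⟩ <;> simp [pathProds]

theorem pathProds_subset_closure (L : List V) :
    pathProds t L ⊆ Submonoid.closure (pathEdges t L) := by
  induction L with
  | nil => simp [pathProds]
  | cons v L ih =>
    rcases L with _ | ⟨w, L⟩
    · simp [pathProds]
    · rintro g (rfl | ⟨c, hc, rfl⟩)
      · exact one_mem _
      · refine mul_mem (Submonoid.subset_closure (mem_pathEdges_cons_cons.2 (.inl rfl))) ?_
        exact Submonoid.closure_mono (pathEdges_subset (List.infix_cons List.infix_rfl)) (ih hc)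

variable [DecidableEq V]

/-- Elements `t v w` of a group, for adjacent vertices `v` and `w` of a graph, that act on the
vertices as transpositions and satisfy the Coxeter relations of transpositions. -/
structure IsTranspositionSystem (adj : V → V → Prop) (t : V → V → G) (φ : G →* Equiv.Perm V) :
    Prop where
  mul_self : ∀ {v w}, adj v w → t v w * t v w = 1
  commute : ∀ {v w x y}, adj v w → adj x y → v ≠ x → v ≠ y → w ≠ x → w ≠ y →
    Commute (t v w) (t x y)
  braid : ∀ {u v w}, adj u v → adj v w → u ≠ w →
    t u v * t v w * t u v = t v w * t u v * t v w
  map : ∀ {v w}, adj v w → φ (t v w) = Equiv.swap v w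

variable {adj : V → V → Prop} {φ : G →* Equiv.Perm V}

namespace IsTranspositionSystem

theorem commute_path (ht : IsTranspositionSystem adj t φ) {L : List V} (hL : L.IsChain adj)
    {v w : V} (h : adj v w) (hv : v ∉ L) (hw : w ∉ L) {g : G}
    (hg : g ∈ Submonoid.closure (pathEdges t L)) : Commute (t v w) g := by
  induction hg using Submonoid.closure_induction with
  | mem g hg =>
    obtain ⟨x, y, hxy, rfl⟩ := hg
    have hx : x ∈ L := hxy.subset (by simp)
    have hy : y ∈ L := hxy.subset (by simp)
    exact ht.commute h (adj_of_infix hL hxy) (fun e => hv (e ▸ hx)) (fun e => hv (e ▸ hy))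
      (fun e => hw (e ▸ hx)) (fun e => hw (e ▸ hy))
  | one => exact .one_right _
  | mul x y _ _ hx hy => exact hx.mul_right hy

/-- This is the coset enumeration step: the products `c` represent the right cosets of the subgroup
generated by the path without `v`. A generator on the right either leads to another representative
or passes through `c` into that subgroup. -/
theorem pathProds_mul (ht : IsTranspositionSystem adj t φ) {v : V} {L : List V}
    (hL : (v :: L).IsChain adj) (hn : (v :: L).Nodup) {c s : G} (hc : c ∈ pathProds t (v :: L))
    (hs : s ∈ pathEdges t (v :: L)) :
    c * s ∈ pathProds t (v :: L) ∨ ∃ s' ∈ pathEdges t L, c * s = s' * c := by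
  induction L generalizing v c s with
  | nil => exact absurd hs not_mem_pathEdges_singleton
  | cons w L ih =>
    have hvw : adj v w := adj_of_infix hL ⟨[], L, rfl⟩
    obtain rfl | ⟨c, hc, rfl⟩ := hc
    · obtain rfl | hs := mem_pathEdges_cons_cons.1 hs
      · exact .inl (.inr ⟨1, one_mem_pathProds _, by simp⟩)
      · exact .inr ⟨s, hs, by simp⟩
    · have hn' := List.nodup_cons.1 hn
      have hn'' := List.nodup_cons.1 hn'.2
      have hvL : v ∉ L := fun h => hn'.1 (by simp [h])
      obtain rfl | hs := mem_pathEdges_cons_cons.1 hs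
      · rcases L with _ | ⟨x, L⟩
        · obtain rfl : c = 1 := hc
          exact .inl (.inl (by simp [ht.mul_self hvw]))
        · obtain rfl | ⟨c, hc, rfl⟩ := hc
          · exact .inl (.inl (by simp [ht.mul_self hvw]))
          -- The factor `t v w` commutes with everything beyond `x`, and then the braid relation
          -- moves it through `t v w * t w x`, where it emerges as `t w x`.
          · refine .inr ⟨t w x, mem_pathEdges_cons_cons.2 (.inl rfl), ?_⟩
            have hwx : adj w x := adj_of_infix hL.tail ⟨[], L, rfl⟩
            have hcomm := ht.commute_path hL.tail.tail hvw hvL hn''.1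
              (pathProds_subset_closure _ hc)
            simp only [List.mem_cons, not_or] at hvL
            have hb := ht.braid hvw hwx hvL.1
            simp only [mul_assoc] at hb ⊢
            rw [← hcomm.eq, ← mul_assoc (t w x), ← mul_assoc (t v w), hb]
            simp only [mul_assoc]
      · obtain h | ⟨s', hs', h⟩ := ih hL.tail hn'.2 hc hs
        · exact .inl (.inr ⟨_, h, by simp [mul_assoc]⟩)
        · refine .inr ⟨s', pathEdges_subset (List.infix_cons List.infix_rfl) hs', ?_⟩
          have hcomm := ht.commute_path hL.tail.tail hvw hvL hn''.1 (Submonoid.subset_closure hs')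
          rw [mul_assoc, h, ← mul_assoc, hcomm.eq, mul_assoc]

theorem exists_mul_pathProds (ht : IsTranspositionSystem adj t φ) {v : V} {L : List V}
    (hL : (v :: L).IsChain adj) (hn : (v :: L).Nodup) {g : G}
    (hg : g ∈ Submonoid.closure (pathEdges t (v :: L))) :
    ∃ h ∈ Submonoid.closure (pathEdges t L), ∃ c ∈ pathProds t (v :: L), g = h * c := by
  induction hg using Submonoid.closure_induction_right with
  | one => exact ⟨1, one_mem _, 1, one_mem_pathProds _, by simp⟩
  | mul_right g _ s hs ih =>
    obtain ⟨h, hh, c, hc, rfl⟩ := ih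
    obtain hcs | ⟨s', hs', e⟩ := ht.pathProds_mul hL hn hc hs
    · exact ⟨h, hh, _, hcs, mul_assoc _ _ _⟩
    · exact ⟨h * s', mul_mem hh (Submonoid.subset_closure hs'), c, hc, by
        rw [mul_assoc, e, mul_assoc]⟩

theorem map_apply_of_notMem (ht : IsTranspositionSystem adj t φ) {L : List V}
    (hL : L.IsChain adj) {v : V} (hv : v ∉ L) {g : G}
    (hg : g ∈ Submonoid.closure (pathEdges t L)) : φ g v = v := by
  induction hg using Submonoid.closure_induction with
  | mem g hg =>
    obtain ⟨x, y, hxy, rfl⟩ := hg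
    have hx : x ∈ L := hxy.subset (by simp)
    have hy : y ∈ L := hxy.subset (by simp)
    rw [ht.map (adj_of_infix hL hxy)]
    exact Equiv.swap_apply_of_ne_of_ne (fun e => hv (e ▸ hx)) (fun e => hv (e ▸ hy))
  | one => simp
  | mul x y _ _ hx hy => rw [map_mul, Equiv.Perm.mul_apply, hy, hx]

theorem pathProds_cases (ht : IsTranspositionSystem adj t φ) {v : V} {L : List V}
    (hL : (v :: L).IsChain adj) {c : G} (hc : c ∈ pathProds t (v :: L)) :
    c = 1 ∨ ∃ w ∈ L, φ c w = v := by
  induction L generalizing v c with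
  | nil => exact .inl hc
  | cons w L ih =>
    obtain rfl | ⟨c, hc, rfl⟩ := hc
    · exact .inl rfl
    · have hvw : adj v w := adj_of_infix hL ⟨[], L, rfl⟩
      right
      obtain rfl | ⟨u, hu, h⟩ := ih hL.tail hc
      · exact ⟨w, by simp, by simp [ht.map hvw]⟩
      · exact ⟨u, by simp [hu], by simp [ht.map hvw, h]⟩

/-- Write `g = k * c` with `k` supported on the path without `v`. A nontrivial `c` would send some
`w ≠ v` to `v`, which `k` fixes, so `g` would move `w`. Hence `c = 1`, and the shorter path takes
over. -/
theorem eq_one_of_map_eq_one (ht : IsTranspositionSystem adj t φ) {L : List V}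
    (hL : L.IsChain adj) (hn : L.Nodup) {g : G} (hg : g ∈ Submonoid.closure (pathEdges t L))
    (h : φ g = 1) : g = 1 := by
  induction L generalizing g with
  | nil =>
    have : pathEdges t ([] : List V) = ∅ :=
      Set.eq_empty_of_forall_notMem fun g ⟨x, y, h, _⟩ => by simpa using h.length_le
    simpa [this] using hg
  | cons v L ih =>
    obtain ⟨k, hk, c, hc, rfl⟩ := ht.exists_mul_pathProds hL hn hg
    have hv := (List.nodup_cons.1 hn).1
    obtain rfl | ⟨w, hw, e⟩ := ht.pathProds_cases hL hc
    · rw [mul_one] at h ⊢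
      exact ih hL.tail (List.nodup_cons.1 hn).2 hk h
    · have h' : φ (k * c) w = w := by rw [h]; rfl
      rw [map_mul, Equiv.Perm.mul_apply, e, ht.map_apply_of_notMem hL.tail hv hk] at h'
      exact absurd (h' ▸ hw) hv

end IsTranspositionSystem

end Path

/-! ### Edges of the hypercube as transpositions -/

/-- The neighbour of `x` in direction `q` in the hypercube. -/
def flipBit (x : Fin n → Bool) (q : Fin n) : Fin n → Bool := Function.update x q (!x q)

theorem flipBit_self (x : Fin n → Bool) (q : Fin n) : flipBit x q q = !x q := by simp [flipBit]

theorem flipBit_of_ne (x : Fin n → Bool) {i q : Fin n} (h : i ≠ q) : flipBit x q i = x i := by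
  simp [flipBit, h]

theorem eq_flipBit {x y : Fin n → Bool} {q : Fin n} (hq : x q ≠ y q)
    (h : ∀ i, i ≠ q → x i = y i) : y = flipBit x q := by
  funext i
  by_cases hi : i = q
  · subst hi
    rw [flipBit_self, Bool.eq_not_of_ne hq, Bool.not_not]
  · rw [flipBit_of_ne _ hi, h i hi]

theorem flipBit_flipBit (x : Fin n → Bool) (q : Fin n) : flipBit (flipBit x q) q = x := by
  simp [flipBit]

theorem flipBit_injective (x : Fin n → Bool) : Function.Injective (flipBit x) := by
  intro p q h
  by_contra hpq
  have := congrFun h p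
  rw [flipBit_self, flipBit_of_ne _ hpq] at this
  simp at this

theorem edge_flipBit (x : Fin n → Bool) (q : Fin n) : edge (flipBit x q) q = edge x q :=
  edge_update_self x q _

/-- Adjacency of vertices of the hypercube. -/
def CubeAdj (x y : Fin n → Bool) : Prop := ∃ q, y = flipBit x q

open Classical in
/-- The full gate that exchanges two adjacent vertices of the hypercube. -/
noncomputable def edgeBetween (x y : Fin n → Bool) : CircuitGroup n :=
  if h : ∃ q, y = flipBit x q then edge x h.choose else 1

theorem edgeBetween_flipBit (x : Fin n → Bool) (q : Fin n) :
    edgeBetween x (flipBit x q) = edge x q := by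
  have h : ∃ p, flipBit x q = flipBit x p := ⟨q, rfl⟩
  rw [edgeBetween, dif_pos h, ← flipBit_injective x h.choose_spec]

theorem toPerm_edge (x : Fin n → Bool) (q : Fin n) :
    CircuitGroup.toPerm (edge x q) = Equiv.swap x (flipBit x q) := by
  rw [edge, CircuitGroup.toPerm_gate]
  ext1 y
  rw [Gate.toPerm_apply]
  by_cases h : ∀ i, i ≠ q → x i = y i
  · rw [Gate.apply_of_fires]
    · change flipBit y q = _
      by_cases hq : x q = y q
      · obtain rfl : x = y := funext fun i => by
          by_cases hi : i = q
          · rw [hi, hq]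
          · exact h i hi
        rw [Equiv.swap_apply_left]
      · obtain rfl := eq_flipBit hq h
        rw [Equiv.swap_apply_right, flipBit_flipBit]
    · rw [Gate.fires_ofControls]
      rintro i hi b ⟨⟩
      exact (h i hi).symm
  · rw [Gate.apply_of_not_fires]
    · rw [Equiv.swap_apply_of_ne_of_ne]
      · rintro rfl
        exact h fun _ _ => rfl
      · rintro rfl
        exact h fun i hi => (flipBit_of_ne x hi).symm
    · rw [Gate.fires_ofControls]
      exact fun h' => h fun i hi => (h' i hi _ rfl).symm

/-- If `x` and `y` differ at a bit other than `p` and `q`, rule 3 applies. Otherwise both edges lie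
in one face of directions `p`, `q`, where they coincide or share a vertex, contrary to disjointness.
-/
theorem edge_commute_of_disjoint {x y : Fin n → Bool} {p q : Fin n} (h₁ : x ≠ y)
    (h₂ : x ≠ flipBit y q) (h₃ : flipBit x p ≠ y) (h₄ : flipBit x p ≠ flipBit y q) :
    Commute (edge x p) (edge y q) := by
  by_cases h : ∃ r, r ≠ p ∧ r ≠ q ∧ x r ≠ y r
  · obtain ⟨r, hp, hq, hr⟩ := h
    exact edge_commute hp hq hr
  · push Not at h
    exfalso
    by_cases hp : x p = y p
    · by_cases hq : x q = y q
      · exact h₁ (funext fun i => by grind)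
      · exact h₂ (eq_flipBit (Ne.symm hq) fun i hi => by grind)
    · by_cases hq : x q = y q
      · exact h₃ (eq_flipBit hp fun i hi => by grind).symm
      · by_cases hpq : p = q
        · subst hpq
          exact h₃ (eq_flipBit hp fun i hi => by grind).symm
        · refine h₄ (eq_flipBit (Ne.symm ?_) fun i hi => ?_)
          · rwa [flipBit_of_ne _ (Ne.symm hpq)]
          · by_cases hi' : i = p
            · subst hi'
              rw [flipBit_self, Bool.eq_not_of_ne hp, Bool.not_not]
            · rw [flipBit_of_ne _ hi', h i hi' hi]

theorem isTranspositionSystem_edgeBetween :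
    IsTranspositionSystem CubeAdj (edgeBetween (n := n)) CircuitGroup.toPerm where
  mul_self := by
    rintro v _ ⟨q, rfl⟩
    rw [edgeBetween_flipBit, edge_mul_self]
  commute := by
    rintro v _ x _ ⟨p, rfl⟩ ⟨q, rfl⟩ h₁ h₂ h₃ h₄
    rw [edgeBetween_flipBit, edgeBetween_flipBit]
    exact edge_commute_of_disjoint h₁ h₂ h₃ h₄
  braid := by
    rintro u _ _ ⟨p, rfl⟩ ⟨q, rfl⟩ h
    rw [edgeBetween_flipBit, edgeBetween_flipBit, ← edge_flipBit u p]
    refine edge_braid _ ?_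
    rintro rfl
    exact h (flipBit_flipBit u p).symm
  map := by
    rintro v _ ⟨q, rfl⟩
    rw [edgeBetween_flipBit, toPerm_edge]

/-! ### A Hamiltonian path that generates the group -/

theorem induction_update {P : (Fin n → Bool) → Prop} {S : Set (Fin n)}
    (h : ∀ z, P z → ∀ i ∈ S, ∀ b, P (Function.update z i b)) {x y : Fin n → Bool}
    (hxy : ∀ i, i ∉ S → y i = x i) (hx : P x) : P y := by
  have key (T : Finset (Fin n)) : P fun i => if i ∈ T then y i else x i := by
    induction T using Finset.induction_on with
    | empty => simpa using hx
    | insert j T hj ih =>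
      by_cases hjS : j ∈ S
      · convert h _ ih j hjS (y j) using 1
        funext i
        by_cases hi : i = j
        · subst hi; simp
        · simp [hi]
      · convert ih using 1
        funext i
        by_cases hi : i = j
        · subst hi; simp [hj, hxy i hjS]
        · simp [hi]
  simpa using key Finset.univ

/-- As for Gray codes, paths through two opposite faces of dimension `k` are joined by one edge in
direction `k`; prescribing the starting vertex makes the ends fit. That linking edge generates, with
the edges inside the two faces, all others in its direction. -/
theorem exists_path_subcube (k : ℕ) (hk : k ≤ n) (x : Fin n → Bool) :
    ∃ L : List (Fin n → Bool), L.head? = some x ∧ L.Nodup ∧ L.IsChain CubeAdj ∧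
      (∀ y, y ∈ L ↔ ∀ i : Fin n, k ≤ i → y i = x i) ∧
      ∀ y ∈ L, ∀ q : Fin n, (q : ℕ) < k →
        edge y q ∈ Submonoid.closure (pathEdges edgeBetween L) := by
  induction k generalizing x with
  | zero =>
    refine ⟨[x], rfl, by simp, by simp, fun y => ?_, fun y _ q hq => absurd hq (by simp)⟩
    simp [funext_iff]
  | succ k ih =>
    obtain ⟨L, hhead, hn, hL, hmem, hedge⟩ := ih (by omega) x
    have hne : L ≠ [] := by rintro rfl; simp at hhead
    let y := L.getLast hne
    let j : Fin n := ⟨k, hk⟩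
    obtain ⟨L', hhead', hn', hL', hmem', hedge'⟩ := ih (by omega) (flipBit y j)
    have hy : y ∈ L := List.getLast_mem hne
    have hyx := (hmem y).1 hy
    have hj : flipBit y j j = !x j := by rw [flipBit_self, hyx j le_rfl]
    have hcube (z) : z ∈ L ++ L' ↔ ∀ i : Fin n, k + 1 ≤ i → z i = x i := by
      rw [List.mem_append, hmem, hmem']
      constructor
      · rintro (h | h) i hi
        · exact h i (by omega)
        · rw [h i (by omega), flipBit_of_ne, hyx i (by omega)]
          rintro rfl
          simp [j] at hi
      · intro h
        by_cases hz : z j = x j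
        · left
          intro i hi
          by_cases hij : i = j
          · rw [hij, hz]
          · exact h i (by have : (i : ℕ) ≠ k := fun e => hij (Fin.ext e)
                          omega)
        · right
          intro i hi
          by_cases hij : i = j
          · rw [hij, hj, Bool.eq_not_of_ne hz]
          · have : (i : ℕ) ≠ k := fun e => hij (Fin.ext e)
            rw [flipBit_of_ne _ hij, hyx i hi, h i (by omega)]
    refine ⟨L ++ L', by simp [hhead], ?_, ?_, hcube, ?_⟩
    · refine hn.append hn' fun z hz hz' => ?_
      have h₁ := (hmem z).1 hz j le_rfl
      have h₂ := (hmem' z).1 hz' j le_rfl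
      rw [hj, h₁] at h₂
      simp at h₂
    · refine List.isChain_append.2 ⟨hL, hL', fun a ha b hb => ?_⟩
      rw [List.getLast?_eq_some_getLast hne] at ha
      rw [hhead'] at hb
      obtain rfl : y = a := by simpa using ha
      obtain rfl : flipBit y j = b := by simpa using hb
      exact ⟨j, rfl⟩
    · have hface : ∀ z ∈ L ++ L', ∀ q : Fin n, (q : ℕ) < k →
          edge z q ∈ Submonoid.closure (pathEdges edgeBetween (L ++ L')) := by
        intro z hz q hq
        rcases List.mem_append.1 hz with hz | hz
        · exact Submonoid.closure_mono (pathEdges_subset ⟨[], L', by simp⟩) (hedge z hz q hq)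
        · exact Submonoid.closure_mono (pathEdges_subset ⟨L, [], by simp⟩) (hedge' z hz q hq)
      have hlink : edge y j ∈ Submonoid.closure (pathEdges edgeBetween (L ++ L')) := by
        refine Submonoid.subset_closure ⟨y, flipBit y j, ?_, (edgeBetween_flipBit y j).symm⟩
        obtain ⟨M', rfl⟩ : ∃ M', L' = flipBit y j :: M' := by
          cases L' with
          | nil => simp at hhead'
          | cons a M => exact ⟨M, by simp at hhead'; rw [hhead']⟩
        refine ⟨L.dropLast, M', ?_⟩
        conv_rhs => rw [← List.dropLast_append_getLast hne]
        simp [y]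
      intro z hz q hq
      rcases Nat.lt_succ_iff_lt_or_eq.1 hq with hq | hq
      · exact hface z hz q hq
      · have hqj : q = j := Fin.ext hq
        rw [← hqj] at hlink
        -- The linking edge is carried from `y` to `z` bit by bit. Changing bit `q` leaves the edge
        -- as it is; changing a bit `i` below `k` crosses a square whose `i`-edges are already
        -- generated.
        refine (induction_update (S := {i | (i : ℕ) ≤ k}) (x := y)
          (P := fun z => z ∈ L ++ L' ∧
            edge z q ∈ Submonoid.closure (pathEdges edgeBetween (L ++ L'))) ?_ ?_ ?_).2
        · rintro w ⟨hw, hwe⟩ i hi b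
          have hupd (i : Fin n) (hi : (i : ℕ) ≤ k) (b : Bool) : Function.update w i b ∈ L ++ L' := by
            rw [hcube] at hw ⊢
            intro m hm
            rw [Function.update_of_ne, hw m hm]
            rintro rfl
            omega
          refine ⟨hupd i hi b, ?_⟩
          by_cases hiq : i = q
          · subst hiq
            rwa [edge_update_self]
          · refine edge_mem_of_square (b := w i) hiq (fun b' => ?_) ?_ b
            · refine hface _ (hupd q hq.le b') i ?_
              have : (i : ℕ) ≠ k := fun e => hiq (Fin.ext (e.trans hq.symm))
              exact lt_of_le_of_ne hi this
            · rwa [Function.update_eq_self]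
        · intro i hi
          have hi : k + 1 ≤ i := by simpa using hi
          rw [(hcube z).1 hz i hi, hyx i (by omega)]
        · exact ⟨List.mem_append_left _ hy, hlink⟩

theorem CircuitGroup.toPerm_injective : Function.Injective (CircuitGroup.toPerm (n := n)) := by
  rw [injective_iff_map_eq_one]
  intro g hg
  obtain ⟨L, -, hn, hL, hmem, hedge⟩ := exists_path_subcube n le_rfl fun _ => true
  refine isTranspositionSystem_edgeBetween.eq_one_of_map_eq_one hL hn ?_ hg
  have h : (⊤ : Submonoid (CircuitGroup n)) ≤ Submonoid.closure (pathEdges edgeBetween L) := by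
    rw [← closure_edge, Submonoid.closure_le]
    rintro _ ⟨x, p, rfl⟩
    exact hedge x ((hmem x).2 fun i hi => absurd i.2 (not_lt.2 hi)) p p.2
  exact h trivial

end ReversibleCircuit

theorem mainTheorem1 (n : ℕ) (A B : ReversibleCircuit.Circuit n) (h : A.Equivalent B) :
    A.Transformable B := by
  refine (ReversibleCircuit.Circuit.cls_eq_iff.1
    (ReversibleCircuit.CircuitGroup.toPerm_injective ?_)).1
  rw [ReversibleCircuit.CircuitGroup.toPerm_cls, ReversibleCircuit.CircuitGroup.toPerm_cls, h]
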